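/- Let $d\ge 1$ and $p\in[0,1]$. The quantum erasure channel $\mathcal N=\mathcal N_p^{A'\to B}$ with $|A'|=d$, $|B|=d+1$ transmits its input with probability $1-p$ and replaces it, with probability $p$, by a fixed state $|e\rangle$ orthogonal to the embedded input space; its Kraus operators are $\sqrt{1-p}\sum_{i=1}^d|i\rangle\langle i|$ and $\sqrt p\,|e\rangle\langle i|$, $i=1,\dots,d$. Let $Q(\mathcal N)=\max_{\rho^{AA'}}\left[H(B)_\sigma-H(AB)_\sigma\right]$, $\sigma^{AB}=(\mathrm{id}\otimes\mathcal N)(\rho^{AA'})$, be its coherent information, where the maximum is over all finite-dimensional systems $A$ and all states $\rho^{AA'}$, and $H(\rho)=-\mathrm{Tr}\,\rho\ln\rho$. Consider $n\ge1$ uses of the channel. Let $|\phi\rangle^{AS}$ be a unit vector whose marginal on $S$ is completely mixed, and let $\mathcal R=\frac1n\ln|S|$ be the rate. Let the joint state $\rho^{AA'^n}$ of $A$ and the $n$ channel inputs be a pure maximally entangled state of full Schmidt rank $d^n$. For a code with encoder $\mathcal E^{S\to A'^n}$ this state is $\rho^{AA'^n}=(\mathrm{id}\otimes\mathcal E)(|\phi\rangle\langle\phi|)$,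 but no relation between $\rho^{AA'^n}$ and $\phi$ is required. Let the receiver apply any quantum operation $\mathcal T^{B^n\to\hat S}$ with $|\hat S|=|S|$, and let $F=\langle\phi|\,(\mathrm{id}\otimes\mathcal T)(\mathrm{id}\otimes\mathcal N^{\otimes n})(\rho^{AA'^n})\,|\phi\rangle$ be the fidelity. Then: 1. The maximum defining $Q(\mathcal N)$ is attained and $Q(\mathcal N)=(1-2p)^+\ln d$. 2. For every $s\in[-\tfrac12,0)$, $$F\le\exp\{n[s\mathcal R-E_0(s)]\},\qquad E_0(s)=-\ln\left[(1-p)d^{-s}+p\,d^{s}\right].$$ 3. (Strong converse.) For every $R>Q(\mathcal N)$ there is a constant $c>0$, depending only on $d$, $p$ and $R$, such that $F\le e^{-cn}$ for all $n\ge1$ and all choices of $A$, $S$, $\phi$, $\rho^{AA'^n}$ and $\mathcal T$ as above with rate $\mathcal R\ge R$. -/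

import Mathlib

open scoped Matrix ComplexOrder

noncomputable section

/-! Finite-dimensional quantum systems are described by finite index types: operators on the space
with orthonormal basis `ι` are matrices over `ι`, and the system `A ⊗ B` is indexed by `α × β`. -/

/-- The rank-one operator `|ψ⟩⟨ψ|`. -/
def ketbra {ι : Type*} (ψ : ι → ℂ) : Matrix ι ι ℂ :=
  Matrix.vecMulVec ψ (star ψ)

/-- Density matrices: positive semidefinite with unit trace. -/
def IsDensity {ι : Type*} [Fintype ι] (ρ : Matrix ι ι ℂ) : Prop :=
  ρ.PosSemidef ∧ ρ.trace = 1

/-- The partial trace over the first system. -/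
def traceLeft {α β : Type*} [Fintype α] (ρ : Matrix (α × β) (α × β) ℂ) : Matrix β β ℂ :=
  Matrix.of fun b b' => ∑ a, ρ (a, b) (a, b')

/-- The map `X ↦ ∑ r, K r * X * (K r)ᴴ` with Kraus operators `K r`. -/
def krausMap {R ι κ : Type*} [Fintype R] [Fintype ι] (K : R → Matrix κ ι ℂ)
    (X : Matrix ι ι ℂ) : Matrix κ κ ℂ :=
  ∑ r, K r * X * (K r)ᴴ

/-- Quantum operations (completely positive trace preserving maps), in Kraus form. -/
def IsChannel {ι κ : Type*} [Fintype ι] [DecidableEq ι] [Fintype κ]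
    (T : Matrix ι ι ℂ → Matrix κ κ ℂ) : Prop :=
  ∃ (r : ℕ) (K : Fin r → Matrix κ ι ℂ), ∑ j, (K j)ᴴ * K j = 1 ∧ T = krausMap K

/-- `id ⊗ T`: the (linear) map `T` acting on the second of two systems. -/
def applyRight {α ι κ : Type*} (T : Matrix ι ι ℂ → Matrix κ κ ℂ)
    (X : Matrix (α × ι) (α × ι) ℂ) : Matrix (α × κ) (α × κ) ℂ :=
  Matrix.of fun u v => T (Matrix.of fun i j => X (u.1, i) (v.1, j)) u.2 v.2

/-- The Kraus operators of the erasure channel with input dimension `d`. The output basis is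
`Option (Fin d)`, where `none` labels the erasure state `|e⟩`. The operator labelled `none` is
`√(1-p) ∑ i, |i⟩⟨i|`, and the operator labelled `some i` is `√p |e⟩⟨i|`. -/
def erasureKraus (d : ℕ) (p : ℝ) : Option (Fin d) → Matrix (Option (Fin d)) (Fin d) ℂ
  | none => Matrix.of fun y x => if y = some x then (Real.sqrt (1 - p) : ℂ) else 0
  | some i => Matrix.of fun y x => if y = none ∧ x = i then (Real.sqrt p : ℂ) else 0

/-- The quantum erasure channel. -/
def erasureChannel (d : ℕ) (p : ℝ) :
    Matrix (Fin d) (Fin d) ℂ → Matrix (Option (Fin d)) (Option (Fin d)) ℂ :=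
  krausMap (erasureKraus d p)

/-- The Kraus operators of the `n`-fold tensor power of a channel with Kraus operators `K r`:
all tensor products `K (f 0) ⊗ ⋯ ⊗ K (f (n-1))`. -/
def tensorPowKraus {R ι κ : Type*} (K : R → Matrix κ ι ℂ) (n : ℕ) (f : Fin n → R) :
    Matrix (Fin n → κ) (Fin n → ι) ℂ :=
  Matrix.of fun y x => ∏ k, K (f k) (y k) (x k)

/-- `n` independent uses of the quantum erasure channel. -/
def erasureChannelPow (d : ℕ) (p : ℝ) (n : ℕ) :
    Matrix (Fin n → Fin d) (Fin n → Fin d) ℂ →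
      Matrix (Fin n → Option (Fin d)) (Fin n → Option (Fin d)) ℂ :=
  krausMap (tensorPowKraus (erasureKraus d p) n)

/-- The von Neumann entropy `-Tr ρ ln ρ` of a Hermitian matrix, through its eigenvalues. -/
def vonNeumannEntropy {ι : Type*} [Fintype ι] [DecidableEq ι] (ρ : Matrix ι ι ℂ) : ℝ :=
  open Classical in
  if h : ρ.IsHermitian then ∑ i, Real.negMulLog (h.eigenvalues i) else 0

/-- The coherent information `I(A⟩B) = H(B) - H(A,B)`. -/
def coherentInfo {α β : Type*} [Fintype α] [DecidableEq α] [Fintype β] [DecidableEq β]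
    (σ : Matrix (α × β) (α × β) ℂ) : ℝ :=
  vonNeumannEntropy (traceLeft σ) - vonNeumannEntropy σ

/-- The values `I(A⟩B)` at `(id ⊗ N)(ρ)`, for all states `ρ` of the channel input together with
an arbitrary finite-dimensional reference system `A`. -/
def coherentInfoValues {ι κ : Type*} [Fintype ι] [Fintype κ] [DecidableEq κ]
    (N : Matrix ι ι ℂ → Matrix κ κ ℂ) : Set ℝ :=
  {x | ∃ (a : ℕ) (ρ : Matrix (Fin a × ι) (Fin a × ι) ℂ),
    IsDensity ρ ∧ x = coherentInfo (applyRight N ρ)}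

/-- The coherent information `Q(N)` of a channel. -/
def channelCoherentInfo {ι κ : Type*} [Fintype ι] [Fintype κ] [DecidableEq κ]
    (N : Matrix ι ι ℂ → Matrix κ κ ℂ) : ℝ :=
  sSup (coherentInfoValues N)

/-- `ρ` is a (pure) maximally entangled state of Schmidt rank `r`: `ρ = |ψ⟩⟨ψ|` where
`ψ = r^{-1/2} ∑ i, e i ⊗ f i` for orthonormal families `e`, `f` of `r` vectors. -/
def IsMaxEntangled {α β : Type*} [Fintype α] [Fintype β] (r : ℕ)
    (ρ : Matrix (α × β) (α × β) ℂ) : Prop :=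
  0 < r ∧ ∃ (e : Fin r → EuclideanSpace ℂ α) (f : Fin r → EuclideanSpace ℂ β),
    Orthonormal ℂ e ∧ Orthonormal ℂ f ∧
      ρ = ketbra fun u => ((Real.sqrt r : ℂ))⁻¹ * ∑ i, e i u.1 * f i u.2

/-- `φ` is a unit vector of the system `A S`, where `S` has dimension `m` and is in the
completely mixed state `1/m`. -/
def IsInformationState {α : Type*} [Fintype α] {m : ℕ} (φ : α × Fin m → ℂ) : Prop :=
  star φ ⬝ᵥ φ = 1 ∧ traceLeft (ketbra φ) = (m : ℂ)⁻¹ • (1 : Matrix (Fin m) (Fin m) ℂ)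

/-- The fidelity `⟨φ|ω|φ⟩`. -/
def pureFidelity {ι : Type*} [Fintype ι] (φ : ι → ℂ) (ω : Matrix ι ι ℂ) : ℝ :=
  (star φ ⬝ᵥ (ω *ᵥ φ)).re

/-- The state of the reference `A` and Bob's decoded system, when the channel inputs of `n` uses
of the erasure channel and `A` are in the state `ρ`, and Bob applies `T` to the outputs. -/
def decodedState {α : Type*} (d : ℕ) (p : ℝ) (n m : ℕ)
    (T : Matrix (Fin n → Option (Fin d)) (Fin n → Option (Fin d)) ℂ → Matrix (Fin m) (Fin m) ℂ)
    (ρ : Matrix (α × (Fin n → Fin d)) (α × (Fin n → Fin d)) ℂ) :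
    Matrix (α × Fin m) (α × Fin m) ℂ :=
  applyRight T (applyRight (erasureChannelPow d p n) ρ)

/-- The communication rate `ln |S| / n` (in nats) of a protocol with `n` channel uses and
`|S| = m`. -/
def commRate (n m : ℕ) : ℝ :=
  Real.log m / n

/-- `E₀(s) = -ln[(1-p) d^{-s} + p d^s]`. -/
def erasureE0 (d : ℕ) (p s : ℝ) : ℝ :=
  -Real.log ((1 - p) * (d : ℝ) ^ (-s) + p * (d : ℝ) ^ s)

end

/-!
Coherent information: sorting the outputs into transmitted and erased ones makes the output states
block diagonal, so `I(A⟩B) = (1 - p) (H(A') - H(AA')) - p H(A)`. The Araki–Lieb inequality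
`H(A') ≤ H(AA') + H(A)` and `H(A') ≤ ln d` bound this by `(1 - 2p)⁺ ln d`. On pure states it equals
`(1 - 2p) H(A)`, and a maximally entangled or a product state attains the bound.

Fidelity: bipartite vectors are written as matrices, so that the fidelity is a sum of terms
`|tr (Φᴴ Lⱼ K_f Ψ)|²` over the Kraus operators `Lⱼ` of the receiver and `K_f` of the channel. Fix
the set `S` of transmitted uses and let `q` be its probability. The vectors `K_f Ψ` are then
pairwise orthogonal of squared length `q / d ^ (n - |S|)`, and their outputs span dimension
`d ^ |S|`. By Cauchy–Schwarz these terms contribute at most `q`, and by Bessel's inequality at most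
`q t` with `t = d ^ |S| / (d ^ (n - |S|) m)`, where `m` is the dimension of the information. Now
`min 1 t ≤ t ^ (-s)` for `-1 ≤ s ≤ 0`, and the binomial theorem sums `q t ^ (-s)` over all `S`.

Strong converse: the exponent `s R - E₀(s)` vanishes at `s = 0`, where its derivative
`R - (1 - 2p) ln d` is positive. Hence it is negative for small `s < 0`.
-/

lemma ofReal_sqrt_mul_self {x : ℝ} (hx : 0 ≤ x) : (√x : ℂ) * √x = x := by
  rw [← Complex.ofReal_mul, Real.mul_self_sqrt hx]

section Entropy

open Matrix Polynomial Real
open scoped Kronecker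

section ShannonEntropy

variable {ι α β : Type*} [Fintype ι] [Fintype α] [Fintype β]

lemma sum_negMulLog_le_neg_sum_mul_log {f g : ι → ℝ} (hf : ∀ i, 0 ≤ f i) (hg : ∀ i, 0 ≤ g i)
    (hsum : ∑ i, g i ≤ ∑ i, f i) (hfg : ∀ i, g i = 0 → f i = 0) :
    ∑ i, negMulLog (f i) ≤ -∑ i, f i * log (g i) := by
  have pointwise i : negMulLog (f i) + f i * log (g i) ≤ g i - f i := by
    rcases (hf i).eq_or_lt with h0 | hfi
    · simpa [← h0] using hg i
    have hgi : 0 < g i := (hg i).lt_of_ne fun h => hfi.ne' (hfg i h.symm)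
    calc negMulLog (f i) + f i * log (g i) = f i * log (g i / f i) := by
          rw [negMulLog, log_div hgi.ne' hfi.ne']; ring
      _ ≤ f i * (g i / f i - 1) := by
          gcongr; exact log_le_sub_one_of_pos (div_pos hgi hfi)
      _ = g i - f i := by field_simp
  have := Finset.sum_le_sum fun i (_ : i ∈ Finset.univ) => pointwise i
  rw [Finset.sum_add_distrib, Finset.sum_sub_distrib] at this
  linarith

lemma sum_negMulLog_le_log_card {f : ι → ℝ} (hf : ∀ i, 0 ≤ f i) (hsum : ∑ i, f i = 1) :
    ∑ i, negMulLog (f i) ≤ log (Fintype.card ι) := by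
  have : Nonempty ι := by
    by_contra h
    simp [not_nonempty_iff.1 h] at hsum
  have gibbs := sum_negMulLog_le_neg_sum_mul_log (g := fun _ => (Fintype.card ι : ℝ)⁻¹) hf
    (fun _ => by positivity) (by simp [hsum]) (by simp)
  simpa [← Finset.sum_mul, hsum, log_inv] using gibbs

lemma sum_negMulLog_le_marginals {r : α × β → ℝ} (hr : ∀ u, 0 ≤ r u) (hsum : ∑ u, r u = 1) :
    ∑ u, negMulLog (r u) ≤
      ∑ a, negMulLog (∑ b, r (a, b)) + ∑ b, negMulLog (∑ a, r (a, b)) := by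
  set x : α → ℝ := fun a => ∑ b, r (a, b)
  set y : β → ℝ := fun b => ∑ a, r (a, b)
  have hx0 u (h : x u.1 = 0) : r u = 0 :=
    (Finset.sum_eq_zero_iff_of_nonneg fun b _ => hr _).1 h u.2 (Finset.mem_univ _)
  have hy0 u (h : y u.2 = 0) : r u = 0 :=
    (Finset.sum_eq_zero_iff_of_nonneg fun a _ => hr (a, u.2)).1 h u.1 (Finset.mem_univ _)
  have hx : ∑ a, x a = 1 := (Fintype.sum_prod_type r).symm.trans hsum
  have hy : ∑ b, y b = 1 := (Fintype.sum_prod_type_right r).symm.trans hsum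
  have hlog u : r u * log (x u.1 * y u.2) = r u * log (x u.1) + r u * log (y u.2) := by
    by_cases h : x u.1 = 0 ∨ y u.2 = 0
    · simp [h.elim (hx0 u) (hy0 u)]
    · push Not at h
      rw [log_mul h.1 h.2, mul_add]
  calc ∑ u, negMulLog (r u) ≤ -∑ u : α × β, r u * log (x u.1 * y u.2) := by
        refine sum_negMulLog_le_neg_sum_mul_log hr
          (fun u => mul_nonneg (Finset.sum_nonneg fun _ _ => hr _)
            (Finset.sum_nonneg fun _ _ => hr _)) ?_
          fun u h => (mul_eq_zero.1 h).elim (hx0 u) (hy0 u)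
        rw [Fintype.sum_prod_type, ← Fintype.sum_mul_sum, hx, hy, hsum, one_mul]
    _ = _ := by
        simp only [hlog, Finset.sum_add_distrib, neg_add]
        rw [Fintype.sum_prod_type, Fintype.sum_prod_type_right (f := fun u => r u * log (y u.2))]
        simp only [← Finset.sum_mul, negMulLog, neg_mul, Finset.sum_neg_distrib, x, y]

end ShannonEntropy

section Spectrum

variable {ι κ : Type*} [Fintype ι] [DecidableEq ι] [Fintype κ] [DecidableEq κ]

/-- The sum of `negMulLog` over the (real parts of the) roots of a polynomial, with multiplicity.
At a characteristic polynomial it is the entropy, so invariance properties of the entropy follow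
from those of the characteristic polynomial. -/
noncomputable def rootEntropy (q : ℂ[X]) : ℝ :=
  (q.roots.map fun z => negMulLog z.re).sum

lemma rootEntropy_prod_X_sub_C {ι : Type*} [Fintype ι] (f : ι → ℝ) :
    rootEntropy (∏ i, (X - C (f i : ℂ))) = ∑ i, negMulLog (f i) := by
  rw [rootEntropy, roots_prod _ _ (Finset.prod_ne_zero_iff.2 fun i _ => X_sub_C_ne_zero _)]
  simp

lemma rootEntropy_mul {q r : ℂ[X]} (hq : q ≠ 0) (hr : r ≠ 0) :
    rootEntropy (q * r) = rootEntropy q + rootEntropy r := by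
  simp [rootEntropy, roots_mul (mul_ne_zero hq hr)]

lemma rootEntropy_X_pow_mul (k : ℕ) {q : ℂ[X]} (hq : q ≠ 0) :
    rootEntropy (X ^ k * q) = rootEntropy q := by
  rw [rootEntropy_mul (pow_ne_zero _ X_ne_zero) hq]
  simp [rootEntropy, Multiset.map_nsmul, Multiset.sum_nsmul]

lemma vonNeumannEntropy_of_isHermitian {ρ : Matrix ι ι ℂ} (h : ρ.IsHermitian) :
    vonNeumannEntropy ρ = ∑ i, negMulLog (h.eigenvalues i) := by
  rw [vonNeumannEntropy, dif_pos h]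

lemma vonNeumannEntropy_eq_rootEntropy {ρ : Matrix ι ι ℂ} (h : ρ.IsHermitian) :
    vonNeumannEntropy ρ = rootEntropy ρ.charpoly := by
  rw [vonNeumannEntropy_of_isHermitian h, h.charpoly_eq]
  exact (rootEntropy_prod_X_sub_C _).symm

lemma vonNeumannEntropy_mul_conjTranspose (M : Matrix ι κ ℂ) :
    vonNeumannEntropy (M * Mᴴ) = vonNeumannEntropy (Mᴴ * M) := by
  rw [vonNeumannEntropy_eq_rootEntropy (isHermitian_mul_conjTranspose_self M),
    vonNeumannEntropy_eq_rootEntropy (isHermitian_conjTranspose_mul_self M),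
    ← rootEntropy_X_pow_mul (Fintype.card κ) (charpoly_monic _).ne_zero, charpoly_mul_comm',
    rootEntropy_X_pow_mul _ (charpoly_monic _).ne_zero]

lemma vonNeumannEntropy_transpose {ρ : Matrix ι ι ℂ} (h : ρ.IsHermitian) :
    vonNeumannEntropy ρᵀ = vonNeumannEntropy ρ := by
  rw [vonNeumannEntropy_eq_rootEntropy h, vonNeumannEntropy_eq_rootEntropy h.transpose,
    charpoly_transpose]

lemma vonNeumannEntropy_reindex {ρ : Matrix ι ι ℂ} (h : ρ.IsHermitian) (e : ι ≃ κ) :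
    vonNeumannEntropy (reindex e e ρ) = vonNeumannEntropy ρ := by
  rw [vonNeumannEntropy_eq_rootEntropy h, vonNeumannEntropy_eq_rootEntropy
    (show (reindex e e ρ).IsHermitian from h.submatrix _), charpoly_reindex]

lemma vonNeumannEntropy_star_mul_mul {ρ : Matrix ι ι ℂ} (h : ρ.IsHermitian)
    {U : Matrix ι ι ℂ} (hU : U ∈ unitaryGroup ι ℂ) :
    vonNeumannEntropy (star U * ρ * U) = vonNeumannEntropy ρ := by
  have hconj : (star U * ρ * U).IsHermitian := isHermitian_conjTranspose_mul_mul U h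
  rw [vonNeumannEntropy_eq_rootEntropy h, vonNeumannEntropy_eq_rootEntropy hconj, mul_assoc,
    charpoly_mul_comm, mul_assoc, mem_unitaryGroup_iff.1 hU, mul_one]

lemma vonNeumannEntropy_fromBlocks {ρ : Matrix ι ι ℂ} {τ : Matrix κ κ ℂ} (hρ : ρ.IsHermitian)
    (hτ : τ.IsHermitian) :
    vonNeumannEntropy (fromBlocks ρ 0 0 τ) = vonNeumannEntropy ρ + vonNeumannEntropy τ := by
  rw [vonNeumannEntropy_eq_rootEntropy hρ, vonNeumannEntropy_eq_rootEntropy hτ,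
    vonNeumannEntropy_eq_rootEntropy (hρ.fromBlocks (by simp) hτ), charpoly_fromBlocks_zero₁₂,
    rootEntropy_mul (charpoly_monic _).ne_zero (charpoly_monic _).ne_zero]

lemma vonNeumannEntropy_diagonal (f : ι → ℝ) :
    vonNeumannEntropy (diagonal fun i => (f i : ℂ)) = ∑ i, negMulLog (f i) := by
  rw [vonNeumannEntropy_eq_rootEntropy (isHermitian_diagonal_of_self_adjoint _ (by ext i; simp)),
    charpoly_diagonal, rootEntropy_prod_X_sub_C]

lemma vonNeumannEntropy_completelyMixed [Nonempty ι] :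
    vonNeumannEntropy ((Fintype.card ι : ℂ)⁻¹ • (1 : Matrix ι ι ℂ)) = log (Fintype.card ι) := by
  have : (Fintype.card ι : ℂ)⁻¹ • (1 : Matrix ι ι ℂ) =
      diagonal fun _ => (((Fintype.card ι : ℝ)⁻¹ : ℝ) : ℂ) := by
    simp [smul_one_eq_diagonal]
  rw [this, vonNeumannEntropy_diagonal]
  simp [negMulLog, log_inv]

lemma vonNeumannEntropy_ketbra {ψ : ι → ℂ} (h : star ψ ⬝ᵥ ψ = 1) :
    vonNeumannEntropy (ketbra ψ) = 0 := by
  have hcol : ketbra ψ = replicateCol Unit ψ * (replicateCol Unit ψ)ᴴ := by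
    rw [ketbra, vecMulVec_eq Unit, conjTranspose_replicateCol]
  have hone : (replicateCol Unit ψ)ᴴ * replicateCol Unit ψ = diagonal fun _ => ((1 : ℝ) : ℂ) := by
    ext i j
    simpa [mul_apply, dotProduct] using h
  rw [hcol, vonNeumannEntropy_mul_conjTranspose, hone, vonNeumannEntropy_diagonal]
  simp

lemma sum_eigenvalues_eq_re_trace {ρ : Matrix ι ι ℂ} (h : ρ.IsHermitian) :
    ∑ i, h.eigenvalues i = ρ.trace.re := by
  simp [h.trace_eq_sum_eigenvalues]

lemma star_eigenvectorUnitary_mul_mul {ρ : Matrix ι ι ℂ} (h : ρ.IsHermitian) :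
    star (h.eigenvectorUnitary : Matrix ι ι ℂ) * ρ * (h.eigenvectorUnitary : Matrix ι ι ℂ) =
      diagonal fun i => (h.eigenvalues i : ℂ) := by
  simpa [Unitary.conjStarAlgAut_apply, Function.comp_def] using
    h.conjStarAlgAut_star_eigenvectorUnitary

lemma isHermitian_ofReal_smul {ι : Type*} {ρ : Matrix ι ι ℂ} (h : ρ.IsHermitian) (c : ℝ) :
    ((c : ℂ) • ρ).IsHermitian :=
  h.smul (Complex.conj_ofReal c)

lemma vonNeumannEntropy_ofReal_smul {ρ : Matrix ι ι ℂ} (h : ρ.IsHermitian) (c : ℝ) :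
    vonNeumannEntropy ((c : ℂ) • ρ) = negMulLog c * ρ.trace.re + c * vonNeumannEntropy ρ := by
  have hdiag : (c : ℂ) • (diagonal fun i => (h.eigenvalues i : ℂ)) =
      diagonal fun i => ((c * h.eigenvalues i : ℝ) : ℂ) := by
    rw [← diagonal_smul]
    simp [Pi.smul_def]
  rw [← vonNeumannEntropy_star_mul_mul (isHermitian_ofReal_smul h c) h.eigenvectorUnitary.2,
    Matrix.mul_smul, Matrix.smul_mul, star_eigenvectorUnitary_mul_mul, hdiag,
    vonNeumannEntropy_diagonal,
    vonNeumannEntropy_of_isHermitian h, ← sum_eigenvalues_eq_re_trace h]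
  simp only [negMulLog_mul, Finset.sum_add_distrib, ← Finset.sum_mul, ← Finset.mul_sum]
  ring

lemma vonNeumannEntropy_nonneg {ρ : Matrix ι ι ℂ} (h : IsDensity ρ) : 0 ≤ vonNeumannEntropy ρ := by
  have hsum : ∑ i, h.1.isHermitian.eigenvalues i = 1 := by simp [sum_eigenvalues_eq_re_trace, h.2]
  rw [vonNeumannEntropy_of_isHermitian h.1.isHermitian]
  refine Finset.sum_nonneg fun i _ => negMulLog_nonneg (h.1.eigenvalues_nonneg i) ?_
  exact hsum ▸ Finset.single_le_sum (fun j _ => h.1.eigenvalues_nonneg j) (Finset.mem_univ i)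

lemma vonNeumannEntropy_le_log_card {ρ : Matrix ι ι ℂ} (h : IsDensity ρ) :
    vonNeumannEntropy ρ ≤ log (Fintype.card ι) := by
  rw [vonNeumannEntropy_of_isHermitian h.1.isHermitian]
  exact sum_negMulLog_le_log_card h.1.eigenvalues_nonneg
    (by simp [sum_eigenvalues_eq_re_trace, h.2])

lemma sum_normSq_row_eq_one {U : Matrix ι ι ℂ} (hU : U ∈ unitaryGroup ι ℂ) (i : ι) :
    ∑ j, Complex.normSq (U i j) = 1 := by
  have := congrFun₂ (mem_unitaryGroup_iff.1 hU) i i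
  simp only [mul_apply, star_apply, one_apply_eq, RCLike.star_def, Complex.mul_conj] at this
  exact_mod_cast this

lemma sum_normSq_col_eq_one {U : Matrix ι ι ℂ} (hU : U ∈ unitaryGroup ι ℂ) (j : ι) :
    ∑ i, Complex.normSq (U i j) = 1 := by
  simpa [star_apply, Complex.normSq_conj] using
    sum_normSq_row_eq_one (Unitary.star_mem hU) j

lemma re_diag_eq_sum_normSq_mul_eigenvalues {ρ : Matrix ι ι ℂ} (h : ρ.IsHermitian) (i : ι) :
    (ρ i i).re = ∑ j, Complex.normSq (h.eigenvectorUnitary.1 i j) * h.eigenvalues j := by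
  have : ρ i i =
      ((∑ j, Complex.normSq (h.eigenvectorUnitary.1 i j) * h.eigenvalues j : ℝ) : ℂ) := by
    conv_lhs => rw [h.spectral_theorem, Unitary.conjStarAlgAut_apply, mul_apply]
    push_cast
    refine Finset.sum_congr rfl fun j _ => ?_
    rw [mul_diagonal, star_apply, RCLike.star_def, ← Complex.mul_conj]
    exact mul_right_comm _ _ _
  rw [this, Complex.ofReal_re]

-- The diagonal is the image of the spectrum under a doubly stochastic matrix.
lemma vonNeumannEntropy_le_sum_negMulLog_diag {ρ : Matrix ι ι ℂ} (h : ρ.PosSemidef) :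
    vonNeumannEntropy ρ ≤ ∑ i, negMulLog (ρ i i).re := by
  have hH := h.isHermitian
  have hU := hH.eigenvectorUnitary.2
  calc vonNeumannEntropy ρ = ∑ j, negMulLog (hH.eigenvalues j) :=
        vonNeumannEntropy_of_isHermitian hH
    _ = ∑ i, ∑ j, Complex.normSq (hH.eigenvectorUnitary.1 i j) * negMulLog (hH.eigenvalues j) := by
        rw [Finset.sum_comm]
        simp only [← Finset.sum_mul, sum_normSq_col_eq_one hU, one_mul]
    _ ≤ ∑ i, negMulLog (ρ i i).re := by
        refine Finset.sum_le_sum fun i _ => ?_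
        rw [re_diag_eq_sum_normSq_mul_eigenvalues hH]
        exact concaveOn_negMulLog.le_map_sum (fun j _ => Complex.normSq_nonneg _)
          (sum_normSq_row_eq_one hU i) fun j _ => h.eigenvalues_nonneg j

end Spectrum

section PartialTrace

variable {α β : Type*} [Fintype α] [Fintype β]

/-- The partial trace over the second system. -/
def traceRight {α β : Type*} [Fintype β] (ρ : Matrix (α × β) (α × β) ℂ) : Matrix α α ℂ :=
  Matrix.of fun a a' => ∑ b, ρ (a, b) (a', b)

lemma traceRight_eq_traceLeft_reindex {α : Type*} (ρ : Matrix (α × β) (α × β) ℂ) :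
    traceRight ρ = traceLeft (reindex (Equiv.prodComm α β) (Equiv.prodComm α β) ρ) := rfl

lemma posSemidef_traceLeft {β : Type*} {ρ : Matrix (α × β) (α × β) ℂ} (h : ρ.PosSemidef) :
    (traceLeft ρ).PosSemidef := by
  have : traceLeft ρ = ∑ a, ρ.submatrix (Prod.mk a) (Prod.mk a) := by
    ext b b'
    simp [traceLeft, Matrix.sum_apply]
  rw [this]
  exact posSemidef_sum _ fun a _ => h.submatrix _

lemma trace_traceLeft (ρ : Matrix (α × β) (α × β) ℂ) : (traceLeft ρ).trace = ρ.trace := by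
  simp [trace, traceLeft, Fintype.sum_prod_type_right]

lemma IsDensity.traceLeft {ρ : Matrix (α × β) (α × β) ℂ} (h : IsDensity ρ) :
    IsDensity (traceLeft ρ) :=
  ⟨posSemidef_traceLeft h.1, (trace_traceLeft ρ).trans h.2⟩

lemma IsDensity.reindex {ρ : Matrix α α ℂ} (h : IsDensity ρ) (e : α ≃ β) :
    IsDensity (reindex e e ρ) :=
  ⟨h.1.submatrix _, (Fintype.sum_equiv e.symm _ _ fun _ => rfl).trans h.2⟩

lemma IsDensity.traceRight {ρ : Matrix (α × β) (α × β) ℂ} (h : IsDensity ρ) :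
    IsDensity (traceRight ρ) :=
  (h.reindex (Equiv.prodComm α β)).traceLeft

lemma isDensity_ketbra {ψ : α → ℂ} (h : star ψ ⬝ᵥ ψ = 1) : IsDensity (ketbra ψ) :=
  ⟨posSemidef_vecMulVec_self_star ψ, by rw [ketbra, trace_vecMulVec, dotProduct_comm, h]⟩

lemma IsDensity.star_mul_mul [DecidableEq α] {ρ : Matrix α α ℂ} (h : IsDensity ρ)
    {U : Matrix α α ℂ} (hU : U ∈ unitaryGroup α ℂ) : IsDensity (star U * ρ * U) :=
  ⟨h.1.conjTranspose_mul_mul_same U, by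
    rw [trace_mul_comm, ← mul_assoc, mem_unitaryGroup_iff.1 hU, one_mul, h.2]⟩

lemma trace_traceLeft_mul [DecidableEq α] (ρ : Matrix (α × β) (α × β) ℂ) (Y : Matrix β β ℂ) :
    (traceLeft ρ * Y).trace = (ρ * (1 ⊗ₖ Y)).trace := by
  simp only [trace, diag_apply, mul_apply, traceLeft, of_apply, Fintype.sum_prod_type,
    kroneckerMap_apply, one_apply, ite_mul, one_mul, zero_mul, mul_ite, mul_zero, Finset.sum_mul,
    Finset.sum_ite_irrel, Finset.sum_const_zero, Finset.sum_ite_eq', Finset.mem_univ, if_true]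
  exact (Finset.sum_congr rfl fun b _ => Finset.sum_comm).trans Finset.sum_comm

lemma traceLeft_star_kronecker_mul_mul [DecidableEq α] (ρ : Matrix (α × β) (α × β) ℂ)
    {U : Matrix α α ℂ} (hU : U ∈ unitaryGroup α ℂ) (V : Matrix β β ℂ) :
    traceLeft (star (U ⊗ₖ V) * ρ * (U ⊗ₖ V)) = star V * traceLeft ρ * V := by
  refine ext_iff_trace_mul_right.2 fun Y => ?_
  have hconj : (U ⊗ₖ V) * (1 ⊗ₖ Y) * star (U ⊗ₖ V) = 1 ⊗ₖ (V * Y * star V) := by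
    simp only [star_eq_conjTranspose, conjTranspose_kronecker, ← mul_kronecker_mul, mul_one]
    rw [← star_eq_conjTranspose U, mem_unitaryGroup_iff.1 hU]
  calc (traceLeft (star (U ⊗ₖ V) * ρ * (U ⊗ₖ V)) * Y).trace
      = (ρ * ((U ⊗ₖ V) * (1 ⊗ₖ Y) * star (U ⊗ₖ V))).trace := by
        rw [trace_traceLeft_mul, mul_assoc, mul_assoc, trace_mul_comm]
        simp only [mul_assoc]
    _ = (star V * traceLeft ρ * V * Y).trace := by
        rw [hconj, ← trace_traceLeft_mul, ← mul_assoc, trace_mul_comm]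
        simp only [mul_assoc]

lemma traceRight_star_kronecker_mul_mul [DecidableEq β] (ρ : Matrix (α × β) (α × β) ℂ)
    (U : Matrix α α ℂ) {V : Matrix β β ℂ} (hV : V ∈ unitaryGroup β ℂ) :
    traceRight (star (U ⊗ₖ V) * ρ * (U ⊗ₖ V)) = star U * traceRight ρ * U := by
  have hswap : reindex (Equiv.prodComm α β) (Equiv.prodComm α β) (U ⊗ₖ V) = V ⊗ₖ U := by
    ext u v
    simp [mul_comm]
  rw [traceRight_eq_traceLeft_reindex, traceRight_eq_traceLeft_reindex,
    ← traceLeft_star_kronecker_mul_mul _ hV, ← hswap]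
  simp only [reindex_apply, star_eq_conjTranspose, conjTranspose_submatrix, submatrix_mul_equiv]

lemma traceLeft_ketbra_vec {β : Type*} (M : Matrix β α ℂ) :
    traceLeft (ketbra (vec M)) = M * Mᴴ := rfl

lemma traceRight_ketbra_vec {α : Type*} (M : Matrix β α ℂ) :
    traceRight (ketbra (vec M)) = (Mᴴ * M)ᵀ := by
  ext a a'
  simp [traceRight, ketbra, vecMulVec_apply, mul_apply, mul_comm]

variable [DecidableEq α] [DecidableEq β]

lemma vonNeumannEntropy_traceRight_ketbra (ψ : α × β → ℂ) :
    vonNeumannEntropy (traceRight (ketbra ψ)) = vonNeumannEntropy (traceLeft (ketbra ψ)) := by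
  obtain ⟨M, rfl⟩ := vec_bijective.surjective ψ
  rw [traceRight_ketbra_vec, traceLeft_ketbra_vec,
    vonNeumannEntropy_transpose (isHermitian_conjTranspose_mul_self M),
    vonNeumannEntropy_mul_conjTranspose]

lemma vonNeumannEntropy_le_sum_negMulLog_diag_marginals {ρ : Matrix (α × β) (α × β) ℂ}
    (h : IsDensity ρ) :
    vonNeumannEntropy ρ ≤ ∑ a, negMulLog (traceRight ρ a a).re +
      ∑ b, negMulLog (traceLeft ρ b b).re := by
  refine (vonNeumannEntropy_le_sum_negMulLog_diag h.1).trans ?_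
  have hsum : ∑ u, (ρ u u).re = 1 := by
    rw [← Complex.re_sum]
    exact congrArg Complex.re h.2
  simpa [traceRight, traceLeft] using sum_negMulLog_le_marginals
    (fun u => (Complex.le_def.1 (h.1.diag_nonneg (i := u))).1) hsum

lemma vonNeumannEntropy_subadditive {ρ : Matrix (α × β) (α × β) ℂ} (h : IsDensity ρ) :
    vonNeumannEntropy ρ ≤ vonNeumannEntropy (traceRight ρ) + vonNeumannEntropy (traceLeft ρ) := by
  have hR := h.traceRight.1.isHermitian
  have hL := h.traceLeft.1.isHermitian
  have hU := hR.eigenvectorUnitary.2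
  have hV := hL.eigenvectorUnitary.2
  have hUV := kronecker_mem_unitary hU hV
  calc vonNeumannEntropy ρ = vonNeumannEntropy (star _ * ρ * _) :=
        (vonNeumannEntropy_star_mul_mul h.1.isHermitian hUV).symm
    _ ≤ _ := vonNeumannEntropy_le_sum_negMulLog_diag_marginals (h.star_mul_mul hUV)
    _ = vonNeumannEntropy (traceRight ρ) + vonNeumannEntropy (traceLeft ρ) := by
        rw [traceRight_star_kronecker_mul_mul _ _ hV, traceLeft_star_kronecker_mul_mul _ hU,
          star_eigenvectorUnitary_mul_mul, star_eigenvectorUnitary_mul_mul,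
          vonNeumannEntropy_of_isHermitian hR, vonNeumannEntropy_of_isHermitian hL]
        simp

open scoped MatrixOrder Matrix.Norms.L2Operator in
/-- The Araki–Lieb inequality, which is subadditivity for the complementary marginal of a
purification `vec D` of `ρ`. -/
lemma vonNeumannEntropy_traceLeft_le {ρ : Matrix (α × β) (α × β) ℂ} (h : IsDensity ρ) :
    vonNeumannEntropy (traceLeft ρ) ≤ vonNeumannEntropy ρ + vonNeumannEntropy (traceRight ρ) := by
  obtain ⟨C, hC⟩ : ∃ C : Matrix (α × β) (α × β) ℂ, ρ = C * Cᴴ :=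
    CStarAlgebra.nonneg_iff_eq_mul_star_self.1 h.1.nonneg
  set D : Matrix β ((α × β) × α) ℂ := of fun b u => C (u.2, b) u.1
  have hD : traceLeft (ketbra (vec D)) = traceLeft ρ := by
    rw [hC, traceLeft_ketbra_vec]
    ext b b'
    simp [D, mul_apply, traceLeft, Fintype.sum_prod_type_right]
  set τ := traceRight (ketbra (vec D))
  have hτL : traceLeft τ = traceRight ρ := by
    rw [hC]
    ext a a'
    exact Finset.sum_comm
  have hτR : traceRight τ = (Cᴴ * C)ᵀ := by
    rw [← traceRight_ketbra_vec]
    ext k k'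
    exact (Fintype.sum_prod_type fun u => C u k * star (C u k')).symm
  have hτ : IsDensity τ := IsDensity.traceRight
    ⟨posSemidef_vecMulVec_self_star _, by rw [← trace_traceLeft, hD, trace_traceLeft, h.2]⟩
  calc vonNeumannEntropy (traceLeft ρ) = vonNeumannEntropy τ := by
        rw [← hD, vonNeumannEntropy_traceRight_ketbra]
    _ ≤ vonNeumannEntropy (traceRight τ) + vonNeumannEntropy (traceLeft τ) :=
        vonNeumannEntropy_subadditive hτ
    _ = vonNeumannEntropy ρ + vonNeumannEntropy (traceRight ρ) := by
        rw [hτL, hτR, vonNeumannEntropy_transpose (isHermitian_conjTranspose_mul_self C),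
          ← vonNeumannEntropy_mul_conjTranspose, ← hC]

end PartialTrace

end Entropy

section ErasureCoherentInformation

open Matrix Real

variable {α : Type*} {d : ℕ} {p : ℝ}

lemma erasureChannel_apply (hp0 : 0 ≤ p) (hp1 : p ≤ 1) (X : Matrix (Fin d) (Fin d) ℂ) :
    erasureChannel d p X = of fun y y' => match y, y' with
      | some i, some j => ((1 - p : ℝ) : ℂ) * X i j
      | none, none => (p : ℂ) * X.trace
      | _, _ => 0 := by
  have transmitted y y' : (erasureKraus d p none * X * (erasureKraus d p none)ᴴ) y y' =
      match y, y' with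
      | some i, some j => ((1 - p : ℝ) : ℂ) * X i j
      | _, _ => 0 := by
    rw [← ofReal_sqrt_mul_self (sub_nonneg.2 hp1)]
    rcases y with _ | i <;> rcases y' with _ | j <;>
      simp [mul_apply, erasureKraus, apply_ite (starRingEnd ℂ), mul_right_comm]
  have erased k y y' : (erasureKraus d p (some k) * X * (erasureKraus d p (some k))ᴴ) y y' =
      match y, y' with
      | none, none => (p : ℂ) * X k k
      | _, _ => 0 := by
    rw [← ofReal_sqrt_mul_self hp0]
    rcases y with _ | i <;> rcases y' with _ | j <;>
      simp [mul_apply, erasureKraus, apply_ite (starRingEnd ℂ), mul_right_comm]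
  ext y y'
  rw [erasureChannel, krausMap, Matrix.sum_apply, Fintype.sum_option, transmitted]
  simp only [erased]
  rcases y with _ | i <;> rcases y' with _ | j <;> simp [trace, Finset.mul_sum]

/-- The equivalence that splits the outputs of an erasure channel, together with a reference
system, into transmitted inputs and erasures. -/
def prodOptionEquivSum (α β : Type*) : α × Option β ≃ (α × β) ⊕ α :=
  (((Equiv.refl α).prodCongr (Equiv.optionEquivSumPUnit.{0} β)).trans
    (Equiv.prodSumDistrib α β PUnit.{1})).trans ((Equiv.refl _).sumCongr (Equiv.prodPUnit.{0} α))

lemma applyRight_erasureChannel_eq_reindex_fromBlocks (hp0 : 0 ≤ p) (hp1 : p ≤ 1)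
    (ρ : Matrix (α × Fin d) (α × Fin d) ℂ) :
    applyRight (erasureChannel d p) ρ =
      reindex (prodOptionEquivSum α (Fin d)).symm (prodOptionEquivSum α (Fin d)).symm
        (fromBlocks (((1 - p : ℝ) : ℂ) • ρ) 0 0 ((p : ℂ) • traceRight ρ)) := by
  rw [← reindex_symm, Equiv.eq_symm_apply]
  ext (⟨a, i⟩ | a) (⟨b, j⟩ | b) <;>
    simp [prodOptionEquivSum, applyRight, erasureChannel_apply hp0 hp1, traceRight, trace]

variable [Fintype α]

lemma traceLeft_applyRight_erasureChannel_eq_reindex_fromBlocks (hp0 : 0 ≤ p) (hp1 : p ≤ 1)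
    {ρ : Matrix (α × Fin d) (α × Fin d) ℂ} (h : ρ.trace = 1) :
    traceLeft (applyRight (erasureChannel d p) ρ) =
      reindex (Equiv.optionEquivSumPUnit.{0} (Fin d)).symm
        (Equiv.optionEquivSumPUnit.{0} (Fin d)).symm
        (fromBlocks (((1 - p : ℝ) : ℂ) • traceLeft ρ) 0 0
          (diagonal fun _ : PUnit.{1} => (p : ℂ))) := by
  rw [trace, Fintype.sum_prod_type] at h
  simp only [diag_apply] at h
  rw [← reindex_symm, Equiv.eq_symm_apply]
  ext (i | i) (j | j) <;>
    simp [applyRight, erasureChannel_apply hp0 hp1, traceLeft, trace, ← Finset.mul_sum, h]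

variable [DecidableEq α]

lemma coherentInfo_applyRight_erasureChannel (hp0 : 0 ≤ p) (hp1 : p ≤ 1)
    {ρ : Matrix (α × Fin d) (α × Fin d) ℂ} (h : IsDensity ρ) :
    coherentInfo (applyRight (erasureChannel d p) ρ) =
      (1 - p) * (vonNeumannEntropy (traceLeft ρ) - vonNeumannEntropy ρ) -
        p * vonNeumannEntropy (traceRight ρ) := by
  have hH := isHermitian_ofReal_smul h.1.isHermitian (1 - p)
  have hL := isHermitian_ofReal_smul h.traceLeft.1.isHermitian (1 - p)
  have hR := isHermitian_ofReal_smul h.traceRight.1.isHermitian p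
  have hD : (diagonal fun _ : PUnit.{1} => (p : ℂ)).IsHermitian :=
    isHermitian_diagonal_of_self_adjoint _ (by ext i; simp)
  have hAB : vonNeumannEntropy (applyRight (erasureChannel d p) ρ) =
      negMulLog (1 - p) + (1 - p) * vonNeumannEntropy ρ +
        (negMulLog p + p * vonNeumannEntropy (traceRight ρ)) := by
    rw [applyRight_erasureChannel_eq_reindex_fromBlocks hp0 hp1,
      vonNeumannEntropy_reindex (hH.fromBlocks (by simp) hR), vonNeumannEntropy_fromBlocks hH hR,
      vonNeumannEntropy_ofReal_smul h.1.isHermitian,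
      vonNeumannEntropy_ofReal_smul h.traceRight.1.isHermitian, h.2, h.traceRight.2]
    simp
  have hB : vonNeumannEntropy (traceLeft (applyRight (erasureChannel d p) ρ)) =
      negMulLog (1 - p) + (1 - p) * vonNeumannEntropy (traceLeft ρ) + negMulLog p := by
    rw [traceLeft_applyRight_erasureChannel_eq_reindex_fromBlocks hp0 hp1 h.2,
      vonNeumannEntropy_reindex (hL.fromBlocks (by simp) hD), vonNeumannEntropy_fromBlocks hL hD,
      vonNeumannEntropy_ofReal_smul h.traceLeft.1.isHermitian, vonNeumannEntropy_diagonal,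
      h.traceLeft.2]
    simp
  rw [coherentInfo, hAB, hB]
  ring

lemma coherentInfo_applyRight_erasureChannel_le (hp0 : 0 ≤ p) (hp1 : p ≤ 1)
    {ρ : Matrix (α × Fin d) (α × Fin d) ℂ} (h : IsDensity ρ) :
    coherentInfo (applyRight (erasureChannel d p) ρ) ≤ max 0 (1 - 2 * p) * log d := by
  rw [coherentInfo_applyRight_erasureChannel hp0 hp1 h]
  have hAL := vonNeumannEntropy_traceLeft_le h
  have hρ := vonNeumannEntropy_nonneg h
  have hR := vonNeumannEntropy_nonneg h.traceRight
  have hL := vonNeumannEntropy_le_log_card h.traceLeft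
  rw [Fintype.card_fin] at hL
  rcases le_total (1 - 2 * p) 0 with hp | hp
  · rw [max_eq_left hp]
    nlinarith
  · rw [max_eq_right hp]
    nlinarith

lemma coherentInfo_applyRight_erasureChannel_ketbra (hp0 : 0 ≤ p) (hp1 : p ≤ 1)
    {ψ : α × Fin d → ℂ} (h : star ψ ⬝ᵥ ψ = 1) :
    coherentInfo (applyRight (erasureChannel d p) (ketbra ψ)) =
      (1 - 2 * p) * vonNeumannEntropy (traceRight (ketbra ψ)) := by
  rw [coherentInfo_applyRight_erasureChannel hp0 hp1 (isDensity_ketbra h),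
    vonNeumannEntropy_ketbra h, ← vonNeumannEntropy_traceRight_ketbra]
  ring

lemma zero_mem_coherentInfoValues_erasureChannel (hd : 1 ≤ d) (hp0 : 0 ≤ p) (hp1 : p ≤ 1) :
    0 ∈ coherentInfoValues (erasureChannel d p) := by
  let ψ : Fin 1 × Fin d → ℂ := Pi.single (0, ⟨0, hd⟩) 1
  have hψ : star ψ ⬝ᵥ ψ = 1 := by simp [ψ]
  have hR := (isDensity_ketbra hψ).traceRight
  have hzero : vonNeumannEntropy (traceRight (ketbra ψ)) = 0 :=
    le_antisymm (by simpa using vonNeumannEntropy_le_log_card hR) (vonNeumannEntropy_nonneg hR)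
  refine ⟨1, ketbra ψ, isDensity_ketbra hψ, ?_⟩
  rw [coherentInfo_applyRight_erasureChannel_ketbra hp0 hp1 hψ, hzero, mul_zero]

-- Attained at the maximally entangled vector `d^{-1/2} ∑ i, e i ⊗ e i`.
lemma mul_log_mem_coherentInfoValues_erasureChannel (hd : 1 ≤ d) (hp0 : 0 ≤ p) (hp1 : p ≤ 1) :
    (1 - 2 * p) * log d ∈ coherentInfoValues (erasureChannel d p) := by
  have : Nonempty (Fin d) := ⟨⟨0, hd⟩⟩
  let M : Matrix (Fin d) (Fin d) ℂ := (√d : ℂ)⁻¹ • 1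
  have hM : Mᴴ * M = (Fintype.card (Fin d) : ℂ)⁻¹ • 1 := by
    have : (√d : ℂ) * √d = d := ofReal_sqrt_mul_self d.cast_nonneg
    simp [M, conjTranspose_smul, smul_smul, ← mul_inv, this]
  have hψ : star (vec M) ⬝ᵥ vec M = 1 := by
    have : (d : ℂ) ≠ 0 := by exact_mod_cast (Nat.one_le_iff_ne_zero.1 hd)
    rw [star_vec_dotProduct_vec, hM, trace_smul, trace_one, Fintype.card_fin, smul_eq_mul,
      inv_mul_cancel₀ this]
  refine ⟨d, ketbra (vec M), isDensity_ketbra hψ, ?_⟩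
  rw [coherentInfo_applyRight_erasureChannel_ketbra hp0 hp1 hψ, traceRight_ketbra_vec, hM,
    transpose_smul, transpose_one, vonNeumannEntropy_completelyMixed, Fintype.card_fin]

lemma isGreatest_coherentInfoValues_erasureChannel (hd : 1 ≤ d) (hp0 : 0 ≤ p) (hp1 : p ≤ 1) :
    IsGreatest (coherentInfoValues (erasureChannel d p)) (max 0 (1 - 2 * p) * log d) := by
  refine ⟨?_, ?_⟩
  · rcases le_total (1 - 2 * p) 0 with hp | hp
    · simpa [max_eq_left hp] using zero_mem_coherentInfoValues_erasureChannel hd hp0 hp1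
    · simpa [max_eq_right hp] using mul_log_mem_coherentInfoValues_erasureChannel hd hp0 hp1
  · rintro x ⟨a, ρ, h, rfl⟩
    exact coherentInfo_applyRight_erasureChannel_le hp0 hp1 h

end ErasureCoherentInformation

section EntanglementFidelity

open Matrix Real

variable {α ι κ κ' R J : Type*} [Fintype ι] [Fintype κ]

lemma krausMap_krausMap [Fintype R] [Fintype J] (L : J → Matrix κ' κ ℂ) (K : R → Matrix κ ι ℂ)
    (X : Matrix ι ι ℂ) :
    krausMap L (krausMap K X) = krausMap (fun u : R × J => L u.2 * K u.1) X := by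
  simp only [krausMap, Fintype.sum_prod_type_right, Matrix.mul_sum, Matrix.sum_mul,
    conjTranspose_mul, Matrix.mul_assoc]

lemma applyRight_krausMap_ketbra_vec {κ : Type*} [Fintype R] (K : R → Matrix κ ι ℂ)
    (Ψ : Matrix ι α ℂ) :
    applyRight (krausMap K) (ketbra (vec Ψ)) = ∑ r, ketbra (vec (K r * Ψ)) := by
  ext u v
  have hΨ : of (fun i j => ketbra (vec Ψ) (u.1, i) (v.1, j)) =
      vecMulVec (Ψ.col u.1) (star (Ψ.col v.1)) := rfl
  simp only [applyRight, krausMap, of_apply, hΨ, mul_vecMulVec, vecMulVec_mul, ← star_mulVec,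
    Matrix.sum_apply]
  rfl

lemma pureFidelity_sum [Fintype R] (φ : ι → ℂ) (X : R → Matrix ι ι ℂ) :
    pureFidelity φ (∑ r, X r) = ∑ r, pureFidelity φ (X r) := by
  simp only [pureFidelity, sum_mulVec, dotProduct_sum, Complex.re_sum]

lemma pureFidelity_ketbra (φ v : ι → ℂ) :
    pureFidelity φ (ketbra v) = ‖star φ ⬝ᵥ v‖ ^ 2 := by
  have hv : star v ⬝ᵥ φ = star (star φ ⬝ᵥ v) := by rw [star_dotProduct]
  rw [pureFidelity, ketbra, vecMulVec_mulVec, op_smul_eq_smul, dotProduct_smul, smul_eq_mul, hv,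
    RCLike.star_def, ← Complex.normSq_eq_conj_mul_self, Complex.ofReal_re,
    Complex.normSq_eq_norm_sq]

lemma pureFidelity_applyRight_krausMap [Fintype α] [Fintype R] (K : R → Matrix κ ι ℂ)
    (Φ : Matrix κ α ℂ) (Ψ : Matrix ι α ℂ) :
    pureFidelity (vec Φ) (applyRight (krausMap K) (ketbra (vec Ψ))) =
      ∑ r, ‖(Φᴴ * (K r * Ψ)).trace‖ ^ 2 := by
  simp only [applyRight_krausMap_ketbra_vec, pureFidelity_sum, pureFidelity_ketbra,
    star_vec_dotProduct_vec]

lemma sum_norm_inner_sq_le_of_orthogonal {E : Type*} [NormedAddCommGroup E]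
    [InnerProductSpace ℂ E] [Fintype R] [DecidableEq R] {v : R → E} {c : ℝ}
    (hc : 0 ≤ c) (hv : ∀ r s, inner ℂ (v r) (v s) = if r = s then (c : ℂ) else 0) (x : E) :
    ∑ r, ‖inner ℂ (v r) x‖ ^ 2 ≤ c * ‖x‖ ^ 2 := by
  rcases hc.eq_or_lt with rfl | hc
  · have hv0 r : v r = 0 := by simpa using hv r r
    simp [hv0]
  have hcc : (√c : ℂ)⁻¹ * ((√c : ℂ)⁻¹ * c) = 1 := by
    have : (√c : ℂ) * √c = c := ofReal_sqrt_mul_self hc.le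
    have : (√c : ℂ) ≠ 0 := by exact_mod_cast (sqrt_pos.2 hc).ne'
    field_simp
    simp [*, sq]
  have he : Orthonormal ℂ fun r => (√c : ℂ)⁻¹ • v r := by
    rw [orthonormal_iff_ite]
    intro r s
    rw [inner_smul_left, inner_smul_right, hv, map_inv₀, Complex.conj_ofReal, mul_ite, mul_ite,
      hcc, mul_zero, mul_zero]
  have bessel := he.sum_inner_products_le x (s := Finset.univ)
  have term r : ‖inner ℂ ((√c : ℂ)⁻¹ • v r) x‖ ^ 2 = c⁻¹ * ‖inner ℂ (v r) x‖ ^ 2 := by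
    rw [inner_smul_left, norm_mul, mul_pow, RCLike.norm_conj, norm_inv, Complex.norm_real,
      norm_of_nonneg (sqrt_nonneg c), inv_pow, sq_sqrt hc.le]
  simpa only [term, ← Finset.mul_sum, inv_mul_le_iff₀ hc] using bessel

section Trace

variable [Fintype α]

lemma inner_toLp_vec (A B : Matrix ι α ℂ) :
    inner ℂ (WithLp.toLp 2 (vec A)) (WithLp.toLp 2 (vec B)) = (Aᴴ * B).trace := by
  rw [EuclideanSpace.inner_toLp_toLp, dotProduct_comm, star_vec_dotProduct_vec]

lemma norm_toLp_vec_sq (A : Matrix ι α ℂ) :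
    ‖WithLp.toLp 2 (vec A)‖ ^ 2 = (Aᴴ * A).trace.re := by
  rw [← inner_toLp_vec, ← inner_self_eq_norm_sq (𝕜 := ℂ)]
  rfl

lemma norm_trace_conjTranspose_mul_sq_le (A B : Matrix ι α ℂ) :
    ‖(Aᴴ * B).trace‖ ^ 2 ≤ (Aᴴ * A).trace.re * (Bᴴ * B).trace.re := by
  rw [← inner_toLp_vec, ← norm_toLp_vec_sq, ← norm_toLp_vec_sq, ← mul_pow]
  gcongr
  exact norm_inner_le_norm _ _

lemma sum_norm_trace_conjTranspose_mul_sq_le [Fintype R] [DecidableEq R] {u : R → Matrix ι α ℂ}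
    {c : ℝ} (hc : 0 ≤ c) (hu : ∀ r s, ((u r)ᴴ * u s).trace = if r = s then (c : ℂ) else 0)
    (A : Matrix ι α ℂ) :
    ∑ r, ‖(Aᴴ * u r).trace‖ ^ 2 ≤ c * (Aᴴ * A).trace.re := by
  simp only [← inner_toLp_vec] at hu
  simpa only [← inner_toLp_vec, norm_inner_symm, norm_toLp_vec_sq] using
    sum_norm_inner_sq_le_of_orthogonal hc hu (WithLp.toLp 2 (vec A))

variable [Fintype J] [DecidableEq ι] {L : J → Matrix κ ι ℂ} {Φ : Matrix κ α ℂ}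

lemma sum_norm_trace_sq_le_trace (hL : ∑ j, (L j)ᴴ * L j = 1) (hΦ : (Φᴴ * Φ).trace = 1)
    (X : Matrix ι α ℂ) :
    ∑ j, ‖(Φᴴ * (L j * X)).trace‖ ^ 2 ≤ (Xᴴ * X).trace.re :=
  calc ∑ j, ‖(Φᴴ * (L j * X)).trace‖ ^ 2
      ≤ ∑ j, ((L j * X)ᴴ * (L j * X)).trace.re := Finset.sum_le_sum fun j _ => by
        simpa [hΦ] using norm_trace_conjTranspose_mul_sq_le Φ (L j * X)
    _ = (Xᴴ * (∑ j, (L j)ᴴ * L j) * X).trace.re := by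
        simp only [Matrix.mul_sum, Matrix.sum_mul, trace_sum, Complex.re_sum, conjTranspose_mul,
          Matrix.mul_assoc]
    _ = (Xᴴ * X).trace.re := by rw [hL, Matrix.mul_one]

/- Compressing the receiver's operators to the range of `P` leaves the overlaps unchanged, while
the compressed vectors `P * (L j)ᴴ * Φ` have total squared length `b * tr P`. -/
lemma sum_norm_trace_sq_le_trace_of_isStarProjection [DecidableEq κ] [Fintype R] [DecidableEq R]
    (hL : ∑ j, (L j)ᴴ * L j = 1) {b : ℝ} (hΦ : Φ * Φᴴ = (b : ℂ) • 1) {P : Matrix ι ι ℂ}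
    (hP : IsStarProjection P) {u : R → Matrix ι α ℂ} (hPu : ∀ r, P * u r = u r) {c : ℝ}
    (hc : 0 ≤ c) (hu : ∀ r s, ((u r)ᴴ * u s).trace = if r = s then (c : ℂ) else 0) :
    ∑ r, ∑ j, ‖(Φᴴ * (L j * u r)).trace‖ ^ 2 ≤ c * (b * P.trace.re) := by
  have hPP : P * P = P := hP.isIdempotentElem
  have hPH : Pᴴ = P := hP.isSelfAdjoint
  let W j : Matrix ι α ℂ := P * (L j)ᴴ * Φ
  have overlap r j : Φᴴ * (L j * u r) = (W j)ᴴ * u r := by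
    simp only [W, conjTranspose_mul, conjTranspose_conjTranspose, hPH, Matrix.mul_assoc, hPu]
  have length j : ((W j)ᴴ * W j).trace = b * (P * ((L j)ᴴ * L j)).trace :=
    calc ((W j)ᴴ * W j).trace = (Φᴴ * (L j * (P * P) * (L j)ᴴ * Φ)).trace := by
          simp only [W, conjTranspose_mul, conjTranspose_conjTranspose, hPH, Matrix.mul_assoc]
      _ = (L j * P * (L j)ᴴ * (Φ * Φᴴ)).trace := by
          rw [hPP, trace_mul_comm, Matrix.mul_assoc]
      _ = b * (P * ((L j)ᴴ * L j)).trace := by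
          rw [hΦ, Matrix.mul_smul, Matrix.mul_one, trace_smul, smul_eq_mul, Matrix.mul_assoc,
            trace_mul_comm, Matrix.mul_assoc]
  calc ∑ r, ∑ j, ‖(Φᴴ * (L j * u r)).trace‖ ^ 2 = ∑ j, ∑ r, ‖((W j)ᴴ * u r).trace‖ ^ 2 := by
        simp only [overlap]
        exact Finset.sum_comm
    _ ≤ ∑ j, c * ((W j)ᴴ * W j).trace.re :=
        Finset.sum_le_sum fun j _ => sum_norm_trace_conjTranspose_mul_sq_le hc hu (W j)
    _ = c * (b * P.trace.re) := by
        simp only [length, Complex.re_ofReal_mul]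
        rw [← Finset.mul_sum, ← Finset.mul_sum, ← Complex.re_sum, ← trace_sum, ← Matrix.mul_sum,
          hL, Matrix.mul_one]

end Trace

lemma IsInformationState.trace_conjTranspose_mul [Fintype α] {m : ℕ} {Φ : Matrix (Fin m) α ℂ}
    (h : IsInformationState (vec Φ)) : (Φᴴ * Φ).trace = 1 :=
  (star_vec_dotProduct_vec Φ Φ).symm.trans h.1

lemma IsInformationState.mul_conjTranspose [Fintype α] {m : ℕ} {Φ : Matrix (Fin m) α ℂ}
    (h : IsInformationState (vec Φ)) : Φ * Φᴴ = (((m : ℝ)⁻¹ : ℝ) : ℂ) • 1 := by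
  rw [← traceLeft_ketbra_vec, h.2, Complex.ofReal_inv, Complex.ofReal_natCast]

lemma IsInformationState.pos [Fintype α] {m : ℕ} {φ : α × Fin m → ℂ}
    (h : IsInformationState φ) : 0 < m := by
  refine Nat.pos_of_ne_zero ?_
  rintro rfl
  simpa [dotProduct] using h.1

lemma orthonormal_iff_conjTranspose_mul_self [DecidableEq R] {f : R → EuclideanSpace ℂ ι} :
    Orthonormal ℂ f ↔ (of fun i r => f r i)ᴴ * (of fun i r => f r i) = 1 := by
  rw [orthonormal_iff_ite, ← Matrix.ext_iff]
  simp only [mul_apply, PiLp.inner_apply, RCLike.inner_apply, conjTranspose_apply, of_apply,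
    Matrix.one_apply, mul_comm, RCLike.star_def]

lemma IsMaxEntangled.exists_eq_ketbra_vec [Fintype α] [DecidableEq ι] {r : ℕ}
    (hr : r = Fintype.card ι) {ρ : Matrix (α × ι) (α × ι) ℂ} (h : IsMaxEntangled r ρ) :
    ∃ Ψ : Matrix ι α ℂ, ρ = ketbra (vec Ψ) ∧ Ψ * Ψᴴ = (r : ℂ)⁻¹ • 1 := by
  obtain ⟨-, e, f, he, hf, rfl⟩ := h
  let E : Matrix α (Fin r) ℂ := of fun a i => e i a
  let F : Matrix ι (Fin r) ℂ := of fun x i => f i x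
  have hE : Eᵀ * Eᵀᴴ = 1 := by
    have := congrArg transpose (orthonormal_iff_conjTranspose_mul_self.1 he)
    rwa [transpose_mul, transpose_one, conjTranspose_transpose] at this
  have hF : F * Fᴴ = 1 :=
    (mul_eq_one_comm_of_card_eq _ _ _ ((Fintype.card_fin r).trans hr)).1
      (orthonormal_iff_conjTranspose_mul_self.1 hf)
  have hrr : (√r : ℂ) * √r = r := ofReal_sqrt_mul_self r.cast_nonneg
  refine ⟨(√r : ℂ)⁻¹ • (F * Eᵀ), ?_, ?_⟩
  · congr 1
    ext u
    simp [vec, mul_apply, E, F, mul_comm]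
  · calc _ = ((√r : ℂ) * √r)⁻¹ • (F * (Eᵀ * Eᵀᴴ) * Fᴴ) := by
          simp [conjTranspose_smul, smul_smul, Matrix.mul_assoc]
      _ = (r : ℂ)⁻¹ • 1 := by rw [hrr, hE, Matrix.mul_one, hF]

end EntanglementFidelity

section ErasureFidelity

open Matrix Real

variable {α ι κ R J : Type*}

lemma trace_tensorPowKraus_conjTranspose_mul [Fintype ι] [Fintype κ] (K : R → Matrix κ ι ℂ)
    {n : ℕ} (f g : Fin n → R) :
    ((tensorPowKraus K n f)ᴴ * tensorPowKraus K n g).trace =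
      ∏ k, ((K (f k))ᴴ * K (g k)).trace := by
  simp only [trace, diag_apply, mul_apply, conjTranspose_apply, tensorPowKraus, of_apply,
    star_prod, Fintype.prod_sum, Finset.prod_mul_distrib]

/-- The positions at which a string over `Option κ` has the entry `none`. They are the transmitted
uses if the string labels a Kraus operator of the erasure channel, and the erased uses if it labels
a basis vector of the outputs. -/
def noneSet [Fintype ι] (f : ι → Option κ) : Finset ι :=
  {k | f k = none}

lemma mem_noneSet [Fintype ι] {f : ι → Option κ} {k : ι} : k ∈ noneSet f ↔ f k = none := by
  simp [noneSet]

lemma card_noneSet_eq [Fintype ι] [DecidableEq ι] [Fintype κ] (S : Finset ι) :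
    Fintype.card {f : ι → Option κ // noneSet f = S} = Fintype.card κ ^ Sᶜ.card := by
  classical
  have h : (Finset.univ.filter fun f : ι → Option κ => noneSet f = S) =
      Fintype.piFinset fun k => if k ∈ S then {none} else Finset.univ.erase none := by
    ext f
    simp only [Finset.mem_filter_univ, Finset.ext_iff, mem_noneSet, Fintype.mem_piFinset]
    refine forall_congr' fun k => ?_
    by_cases hk : k ∈ S <;> simp [hk]
  rw [Fintype.card_subtype, h, Fintype.card_piFinset]
  simp [apply_ite Finset.card, Finset.prod_ite, Finset.filter_not, Finset.compl_eq_univ_sdiff]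

/-- The squared Hilbert–Schmidt norms of the Kraus operators of the erasure channel. -/
noncomputable def erasureWeight (d : ℕ) (p : ℝ) : Option (Fin d) → ℝ
  | none => (1 - p) * d
  | some _ => p

/-- The probability that exactly the uses in `S` of an erasure channel are transmitted. -/
noncomputable def transmissionProb [Fintype ι] [DecidableEq ι] (p : ℝ) (S : Finset ι) : ℝ :=
  (1 - p) ^ S.card * p ^ Sᶜ.card

variable {d n : ℕ} {p : ℝ}

lemma transmissionProb_nonneg [Fintype ι] [DecidableEq ι] (hp0 : 0 ≤ p) (hp1 : p ≤ 1)
    (S : Finset ι) : 0 ≤ transmissionProb p S :=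
  mul_nonneg (pow_nonneg (sub_nonneg.2 hp1) _) (pow_nonneg hp0 _)

lemma prod_erasureWeight [Fintype ι] [DecidableEq ι] (f : ι → Option (Fin d)) :
    ∏ k, erasureWeight d p (f k) =
      transmissionProb p (noneSet f) * d ^ (noneSet f).card := by
  rw [← Finset.prod_mul_prod_compl (noneSet f), transmissionProb, mul_right_comm, ← mul_pow,
    ← Finset.prod_const, ← Finset.prod_const]
  congr 1 <;> refine Finset.prod_congr rfl fun k hk => ?_
  · rw [mem_noneSet.1 hk, erasureWeight]
  · rw [Finset.mem_compl, mem_noneSet, ← ne_eq, Option.ne_none_iff_exists] at hk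
    obtain ⟨i, hi⟩ := hk
    rw [← hi, erasureWeight]

lemma trace_erasureKraus_conjTranspose_mul (hp0 : 0 ≤ p) (hp1 : p ≤ 1) (r s : Option (Fin d)) :
    ((erasureKraus d p r)ᴴ * erasureKraus d p s).trace =
      if r = s then (erasureWeight d p r : ℂ) else 0 := by
  rcases r with _ | i <;> rcases s with _ | j <;>
    simp [trace, mul_apply, erasureKraus, erasureWeight, apply_ite (starRingEnd ℂ),
      ofReal_sqrt_mul_self hp0, ofReal_sqrt_mul_self (sub_nonneg.2 hp1), mul_comm,
      eq_comm, -Complex.ofReal_sub]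

lemma tensorPowKraus_erasureKraus_apply_eq_zero {f y : Fin n → Option (Fin d)}
    (hy : noneSet y ≠ (noneSet f)ᶜ) (x : Fin n → Fin d) :
    tensorPowKraus (erasureKraus d p) n f y x = 0 := by
  obtain ⟨k, hk⟩ : ∃ k, ¬(y k = none ↔ f k ≠ none) := by
    by_contra! h
    exact hy (Finset.ext fun k => by simp only [Finset.mem_compl, mem_noneSet, h k, ne_eq])
  refine Finset.prod_eq_zero (Finset.mem_univ k) ?_
  rcases hf : f k with _ | i <;> simp_all [erasureKraus]

lemma trace_tensorPowKraus_erasureKraus_mul [Fintype α] (hd : 1 ≤ d) (hp0 : 0 ≤ p) (hp1 : p ≤ 1)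
    {Ψ : Matrix (Fin n → Fin d) α ℂ} (hΨ : Ψ * Ψᴴ = ((d ^ n : ℕ) : ℂ)⁻¹ • 1)
    (f g : Fin n → Option (Fin d)) :
    ((tensorPowKraus (erasureKraus d p) n f * Ψ)ᴴ *
        (tensorPowKraus (erasureKraus d p) n g * Ψ)).trace =
      if f = g then
        ((transmissionProb p (noneSet f) / d ^ (noneSet f)ᶜ.card : ℝ) : ℂ) else 0 := by
  set K := tensorPowKraus (erasureKraus d p) n
  have : (d : ℂ) ≠ 0 := by exact_mod_cast (Nat.one_le_iff_ne_zero.1 hd)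
  have hK : ((K f * Ψ)ᴴ * (K g * Ψ)).trace = ((d : ℂ) ^ n)⁻¹ * ((K f)ᴴ * K g).trace := by
    rw [conjTranspose_mul, Matrix.mul_assoc, trace_mul_comm, Matrix.mul_assoc, Matrix.mul_assoc,
      hΨ, Matrix.mul_smul, Matrix.mul_smul, Matrix.mul_one, trace_smul, smul_eq_mul, Nat.cast_pow]
  rw [hK, trace_tensorPowKraus_conjTranspose_mul]
  simp only [trace_erasureKraus_conjTranspose_mul hp0 hp1]
  split_ifs with hfg
  · subst hfg
    have hn : (noneSet f).card + (noneSet f)ᶜ.card = n := by simp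
    simp only [if_true, ← Complex.ofReal_prod, prod_erasureWeight]
    nth_rw 1 [← hn]
    push_cast [pow_add]
    field_simp
  · obtain ⟨k, hk⟩ := Function.ne_iff.1 hfg
    rw [Finset.prod_eq_zero (Finset.mem_univ k) (if_neg hk), mul_zero]

/-- The projection onto the outputs in which exactly the uses in `S` are not erased. -/
noncomputable def transmittedProj (d : ℕ) (S : Finset (Fin n)) :
    Matrix (Fin n → Option (Fin d)) (Fin n → Option (Fin d)) ℂ :=
  diagonal fun y => if noneSet y = Sᶜ then 1 else 0

lemma isStarProjection_transmittedProj (S : Finset (Fin n)) :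
    IsStarProjection (transmittedProj d S) := by
  constructor
  · simp [transmittedProj, IsIdempotentElem]
  · exact isHermitian_diagonal_of_self_adjoint _ (by ext y; simp [apply_ite])

lemma trace_transmittedProj (S : Finset (Fin n)) :
    (transmittedProj d S).trace = (d : ℂ) ^ S.card := by
  have h := card_noneSet_eq (κ := Fin d) Sᶜ
  rw [compl_compl, Fintype.card_fin, Fintype.card_subtype] at h
  rw [transmittedProj, trace_diagonal, Finset.sum_boole, h, Nat.cast_pow]

lemma transmittedProj_mul_tensorPowKraus {S : Finset (Fin n)} {f : Fin n → Option (Fin d)}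
    (hf : noneSet f = S) :
    transmittedProj d S * tensorPowKraus (erasureKraus d p) n f =
      tensorPowKraus (erasureKraus d p) n f := by
  subst hf
  ext y x
  rw [transmittedProj, diagonal_mul, ite_mul, one_mul, zero_mul, ite_eq_left_iff]
  exact fun hy => (tensorPowKraus_erasureKraus_apply_eq_zero hy x).symm

lemma sum_norm_trace_sq_le_transmissionProb_mul_min [Fintype α] [Fintype J] (hd : 1 ≤ d)
    (hp0 : 0 ≤ p) (hp1 : p ≤ 1) {m : ℕ} {L : J → Matrix (Fin m) (Fin n → Option (Fin d)) ℂ}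
    (hL : ∑ j, (L j)ᴴ * L j = 1) {Φ : Matrix (Fin m) α ℂ} (hΦ : IsInformationState (vec Φ))
    {Ψ : Matrix (Fin n → Fin d) α ℂ} (hΨ : Ψ * Ψᴴ = ((d ^ n : ℕ) : ℂ)⁻¹ • 1)
    (S : Finset (Fin n)) :
    ∑ f : {f : Fin n → Option (Fin d) // noneSet f = S},
        ∑ j, ‖(Φᴴ * (L j * (tensorPowKraus (erasureKraus d p) n f * Ψ))).trace‖ ^ 2 ≤
      transmissionProb p S * min 1 ((d : ℝ) ^ S.card / (d : ℝ) ^ Sᶜ.card / m) := by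
  set u : {f : Fin n → Option (Fin d) // noneSet f = S} → Matrix _ α ℂ :=
    fun f => tensorPowKraus (erasureKraus d p) n f * Ψ
  set c : ℝ := transmissionProb p S / d ^ Sᶜ.card with hc
  have : (d : ℝ) ≠ 0 := by exact_mod_cast (Nat.one_le_iff_ne_zero.1 hd)
  have hq0 := transmissionProb_nonneg hp0 hp1 S
  have hc0 : 0 ≤ c := by positivity
  have hu f g : ((u f)ᴴ * u g).trace = if f = g then (c : ℂ) else 0 := by
    simp only [u, trace_tensorPowKraus_erasureKraus_mul hd hp0 hp1 hΨ, f.2, Subtype.ext_iff, hc]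
  have hPu f : transmittedProj d S * u f = u f := by
    rw [← Matrix.mul_assoc, transmittedProj_mul_tensorPowKraus f.2]
  rw [mul_min_of_nonneg _ _ hq0]
  refine le_min ?_ ?_
  · calc _ ≤ ∑ f, ((u f)ᴴ * u f).trace.re := Finset.sum_le_sum fun f _ =>
          sum_norm_trace_sq_le_trace hL hΦ.trace_conjTranspose_mul (u f)
      _ = transmissionProb p S * 1 := by
          simp only [hu, if_true, Complex.ofReal_re, Finset.sum_const, Finset.card_univ,
            card_noneSet_eq, Fintype.card_fin, nsmul_eq_mul, Nat.cast_pow, hc]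
          field_simp
  · refine (sum_norm_trace_sq_le_trace_of_isStarProjection hL hΦ.mul_conjTranspose
      (isStarProjection_transmittedProj S) hPu hc0 hu).trans_eq ?_
    rw [trace_transmittedProj, ← Complex.ofReal_natCast, ← Complex.ofReal_pow, Complex.ofReal_re]
    ring

lemma pureFidelity_decodedState_le_sum [Fintype α] (hd : 1 ≤ d) (hp0 : 0 ≤ p) (hp1 : p ≤ 1)
    {m : ℕ} {φ : α × Fin m → ℂ} (hφ : IsInformationState φ)
    {T : Matrix (Fin n → Option (Fin d)) (Fin n → Option (Fin d)) ℂ → Matrix (Fin m) (Fin m) ℂ}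
    (hT : IsChannel T) {ρ : Matrix (α × (Fin n → Fin d)) (α × (Fin n → Fin d)) ℂ}
    (hρ : IsMaxEntangled (d ^ n) ρ) :
    pureFidelity φ (decodedState d p n m T ρ) ≤
      ∑ S : Finset (Fin n),
        transmissionProb p S * min 1 ((d : ℝ) ^ S.card / (d : ℝ) ^ Sᶜ.card / m) := by
  obtain ⟨r, L, hL, rfl⟩ := hT
  obtain ⟨Ψ, rfl, hΨ⟩ := hρ.exists_eq_ketbra_vec (by simp)
  obtain ⟨Φ, rfl⟩ := vec_bijective.surjective φ
  have hcomp : decodedState d p n m (krausMap L) (ketbra (vec Ψ)) =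
      applyRight (krausMap fun u : (Fin n → Option (Fin d)) × Fin r =>
        L u.2 * tensorPowKraus (erasureKraus d p) n u.1) (ketbra (vec Ψ)) := by
    simp only [← funext fun X => krausMap_krausMap L (tensorPowKraus (erasureKraus d p) n) X]
    rfl
  rw [hcomp, pureFidelity_applyRight_krausMap, Fintype.sum_prod_type,
    ← Fintype.sum_fiberwise noneSet]
  simp only [Matrix.mul_assoc]
  exact Finset.sum_le_sum fun S _ =>
    sum_norm_trace_sq_le_transmissionProb_mul_min hd hp0 hp1 hL hφ hΨ S

end ErasureFidelity

section ErrorExponent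

open Real

variable {d : ℕ} {p : ℝ}

lemma min_one_le_rpow {t x : ℝ} (ht : 0 < t) (hx0 : 0 ≤ x) (hx1 : x ≤ 1) : min 1 t ≤ t ^ x := by
  rcases le_total t 1 with h | h
  · rw [min_eq_right h]
    exact self_le_rpow_of_le_one ht.le h hx1
  · rw [min_eq_left h]
    exact one_le_rpow h hx0

lemma erasureE0_base_pos (hd : 1 ≤ d) (hp0 : 0 ≤ p) (hp1 : p ≤ 1) (s : ℝ) :
    0 < (1 - p) * (d : ℝ) ^ (-s) + p * (d : ℝ) ^ s := by
  have hd0 : (0 : ℝ) < d := by exact_mod_cast hd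
  exact (convex_Ioi (0 : ℝ)) (rpow_pos_of_pos hd0 _) (rpow_pos_of_pos hd0 _) (sub_nonneg.2 hp1)
    hp0 (sub_add_cancel 1 p)

lemma exp_commRate_sub_erasureE0 (hd : 1 ≤ d) (hp0 : 0 ≤ p) (hp1 : p ≤ 1) (s : ℝ) {n m : ℕ}
    (hn : 1 ≤ n) (hm : 0 < m) :
    exp (n * (s * commRate n m - erasureE0 d p s)) =
      (m : ℝ) ^ s * ((1 - p) * (d : ℝ) ^ (-s) + p * (d : ℝ) ^ s) ^ n := by
  have hn0 : (n : ℝ) ≠ 0 := by exact_mod_cast (Nat.one_le_iff_ne_zero.1 hn)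
  have hm0 : (0 : ℝ) < m := by exact_mod_cast hm
  have hrate : n * (s * commRate n m) = log m * s := by
    rw [commRate]
    field_simp
  rw [mul_sub, erasureE0, mul_neg, sub_neg_eq_add, exp_add, hrate, ← rpow_def_of_pos hm0,
    exp_nat_mul, exp_log (erasureE0_base_pos hd hp0 hp1 s)]

lemma transmissionProb_mul_rpow {ι : Type*} [Fintype ι] [DecidableEq ι] (p s : ℝ) (d m : ℕ)
    (S : Finset ι) :
    transmissionProb p S * ((d : ℝ) ^ S.card / (d : ℝ) ^ Sᶜ.card / m) ^ (-s) =
      (m : ℝ) ^ s * (((1 - p) * (d : ℝ) ^ (-s)) ^ S.card * (p * (d : ℝ) ^ s) ^ Sᶜ.card) := by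
  have hd0 : (0 : ℝ) ≤ d := d.cast_nonneg
  have hm0 : (0 : ℝ) ≤ m := m.cast_nonneg
  rw [transmissionProb, div_rpow (by positivity) hm0, div_rpow (by positivity) (by positivity),
    ← rpow_pow_comm hd0, ← rpow_pow_comm hd0, rpow_neg hm0, rpow_neg hd0, mul_pow, mul_pow,
    inv_pow, inv_pow, div_inv_eq_mul, div_inv_eq_mul]
  ring

lemma pureFidelity_decodedState_le_exp {α : Type*} [Fintype α] (hd : 1 ≤ d) (hp0 : 0 ≤ p)
    (hp1 : p ≤ 1) {s : ℝ} (hs1 : -1 ≤ s) (hs0 : s ≤ 0) {n m : ℕ} (hn : 1 ≤ n)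
    {φ : α × Fin m → ℂ} (hφ : IsInformationState φ)
    {T : Matrix (Fin n → Option (Fin d)) (Fin n → Option (Fin d)) ℂ → Matrix (Fin m) (Fin m) ℂ}
    (hT : IsChannel T) {ρ : Matrix (α × (Fin n → Fin d)) (α × (Fin n → Fin d)) ℂ}
    (hρ : IsMaxEntangled (d ^ n) ρ) :
    pureFidelity φ (decodedState d p n m T ρ) ≤
      exp (n * (s * commRate n m - erasureE0 d p s)) := by
  have : (0 : ℝ) < d := by exact_mod_cast hd
  have hm0 : (0 : ℝ) < m := by exact_mod_cast hφ.pos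
  calc _ ≤ ∑ S : Finset (Fin n),
        transmissionProb p S * min 1 ((d : ℝ) ^ S.card / (d : ℝ) ^ Sᶜ.card / m) :=
        pureFidelity_decodedState_le_sum hd hp0 hp1 hφ hT hρ
    _ ≤ ∑ S : Finset (Fin n),
        transmissionProb p S * ((d : ℝ) ^ S.card / (d : ℝ) ^ Sᶜ.card / m) ^ (-s) := by
        gcongr with S
        · exact transmissionProb_nonneg hp0 hp1 S
        · exact min_one_le_rpow (by positivity) (by linarith) (by linarith)
    _ = (m : ℝ) ^ s * ((1 - p) * (d : ℝ) ^ (-s) + p * (d : ℝ) ^ s) ^ n := by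
        simp only [transmissionProb_mul_rpow, ← Finset.mul_sum]
        simp only [Finset.card_compl, Fintype.card_fin, Fin.sum_pow_mul_eq_add_pow]
    _ = exp (n * (s * commRate n m - erasureE0 d p s)) :=
        (exp_commRate_sub_erasureE0 hd hp0 hp1 s hn hφ.pos).symm

lemma hasDerivAt_erasureE0 (hd : 1 ≤ d) (p : ℝ) :
    HasDerivAt (erasureE0 d p) ((1 - 2 * p) * log d) 0 := by
  have hd0 : (0 : ℝ) < d := by exact_mod_cast hd
  have hpos : HasDerivAt (fun s : ℝ => (d : ℝ) ^ s) (log d) 0 := by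
    simpa using (hasDerivAt_id (0 : ℝ)).const_rpow hd0
  have hneg : HasDerivAt (fun s : ℝ => (d : ℝ) ^ (-s)) (-log d) 0 := by
    simpa using (hasDerivAt_neg (0 : ℝ)).const_rpow hd0
  have hE0 := (((hneg.const_mul (1 - p)).add (hpos.const_mul p)).log (by simp)).neg
  refine hE0.congr_deriv ?_
  simp only [mul_neg, Pi.add_apply, neg_zero, rpow_zero, mul_one, sub_add_cancel, div_one,
    neg_add_rev, neg_neg]
  ring

lemma exists_mul_sub_erasureE0_neg (hd : 1 ≤ d) {R : ℝ} (hR : (1 - 2 * p) * log d < R) :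
    ∃ s : ℝ, -1 ≤ s ∧ s < 0 ∧ s * R - erasureE0 d p s < 0 := by
  let g : ℝ → ℝ := fun s => s * R - erasureE0 d p s
  have hg0 : g 0 = 0 := by simp [g, erasureE0]
  have hg : HasDerivAt g (R - (1 - 2 * p) * log d) 0 :=
    (((hasDerivAt_id (0 : ℝ)).mul_const R).sub (hasDerivAt_erasureE0 hd p)).congr_deriv (by simp)
  have hsign := eventually_nhdsWithin_sign_eq_of_deriv_pos
    (by rw [hg.deriv]; exact sub_pos.2 hR) hg0
  have hnear : ∀ᶠ s in nhdsWithin (0 : ℝ) (Set.Iio 0), s ∈ Set.Ioo (-1 : ℝ) 0 :=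
    Ioo_mem_nhdsLT (by norm_num)
  obtain ⟨s, hs, hs1, hs0⟩ := ((hsign.filter_mono nhdsWithin_le_nhds).and hnear).exists
  refine ⟨s, hs1.le, hs0, sign_eq_neg_one_iff.1 ?_⟩
  rw [hs, sub_zero, sign_neg hs0]

end ErrorExponent

section StrongConverse

variable {d : ℕ} {p : ℝ}

lemma exists_pureFidelity_decodedState_le_exp_neg.{u} (hd : 1 ≤ d) (hp0 : 0 ≤ p) (hp1 : p ≤ 1)
    {R : ℝ} (hR : (1 - 2 * p) * Real.log d < R) :
    ∃ c : ℝ, 0 < c ∧ ∀ (n m : ℕ) (α : Type u) [Fintype α], 1 ≤ n → R ≤ commRate n m →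
      ∀ φ : α × Fin m → ℂ, IsInformationState φ →
      ∀ T : Matrix (Fin n → Option (Fin d)) (Fin n → Option (Fin d)) ℂ →
          Matrix (Fin m) (Fin m) ℂ, IsChannel T →
      ∀ ρ : Matrix (α × (Fin n → Fin d)) (α × (Fin n → Fin d)) ℂ, IsMaxEntangled (d ^ n) ρ →
        pureFidelity φ (decodedState d p n m T ρ) ≤ Real.exp (-(c * n)) := by
  obtain ⟨s, hs1, hs0, hs⟩ := exists_mul_sub_erasureE0_neg hd hR
  refine ⟨-(s * R - erasureE0 d p s), neg_pos.2 hs, fun n m α _ hn hrate φ hφ T hT ρ hρ => ?_⟩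
  calc _ ≤ Real.exp (n * (s * commRate n m - erasureE0 d p s)) :=
        pureFidelity_decodedState_le_exp hd hp0 hp1 hs1 hs0.le hn hφ hT hρ
    _ ≤ Real.exp (n * (s * R - erasureE0 d p s)) :=
        Real.exp_le_exp.2 (mul_le_mul_of_nonneg_left
          (sub_le_sub_right (mul_le_mul_of_nonpos_left hrate hs0.le) _) n.cast_nonneg)
    _ = Real.exp (-(-(s * R - erasureE0 d p s) * n)) := by ring_nf

end StrongConverse

theorem theorem3_general.{u} (d : ℕ) (hd : 1 ≤ d) (p : ℝ) (hp0 : 0 ≤ p) (hp1 : p ≤ 1) :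
    (IsGreatest (coherentInfoValues (erasureChannel d p))
        (channelCoherentInfo (erasureChannel d p)) ∧
      channelCoherentInfo (erasureChannel d p) = max 0 (1 - 2 * p) * Real.log d) ∧
    (∀ s : ℝ, -1 ≤ s → s ≤ 0 → ∀ (n m : ℕ) (α : Type u) [Fintype α], 1 ≤ n →
      ∀ φ : α × Fin m → ℂ, IsInformationState φ →
      ∀ T : Matrix (Fin n → Option (Fin d)) (Fin n → Option (Fin d)) ℂ →
          Matrix (Fin m) (Fin m) ℂ, IsChannel T →
      ∀ ρ : Matrix (α × (Fin n → Fin d)) (α × (Fin n → Fin d)) ℂ, IsMaxEntangled (d ^ n) ρ →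
        pureFidelity φ (decodedState d p n m T ρ) ≤
          Real.exp (n * (s * commRate n m - erasureE0 d p s))) ∧
    (∀ R : ℝ, (1 - 2 * p) * Real.log d < R → ∃ c : ℝ, 0 < c ∧
      ∀ (n m : ℕ) (α : Type u) [Fintype α], 1 ≤ n → R ≤ commRate n m →
      ∀ φ : α × Fin m → ℂ, IsInformationState φ →
      ∀ T : Matrix (Fin n → Option (Fin d)) (Fin n → Option (Fin d)) ℂ →
          Matrix (Fin m) (Fin m) ℂ, IsChannel T →
      ∀ ρ : Matrix (α × (Fin n → Fin d)) (α × (Fin n → Fin d)) ℂ, IsMaxEntangled (d ^ n) ρ →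
        pureFidelity φ (decodedState d p n m T ρ) ≤ Real.exp (-(c * n))) := by
  have hQ := isGreatest_coherentInfoValues_erasureChannel hd hp0 hp1
  have hsSup : channelCoherentInfo (erasureChannel d p) = max 0 (1 - 2 * p) * Real.log d :=
    hQ.csSup_eq
  exact ⟨⟨hsSup ▸ hQ, hsSup⟩,
    fun s hs1 hs0 n m α _ hn φ hφ T hT ρ hρ =>
      pureFidelity_decodedState_le_exp hd hp0 hp1 hs1 hs0 hn hφ hT hρ,
    fun R hR => exists_pureFidelity_decodedState_le_exp_neg hd hp0 hp1 hR⟩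

/-- Strong converse for the quantum erasure channel with maximally entangled inputs of full
Schmidt rank. In the second and third groups, the first half allows every maximally entangled
channel input `ρ`, also with a Schmidt rank other than that of `φ`; the second half is the
case of inputs `ρ = (id ⊗ E)(|φ⟩⟨φ|)` produced by an encoder `E`. -/
theorem theorem3 (d : ℕ) (hd : 1 ≤ d) (p : ℝ) (hp0 : 0 ≤ p) (hp1 : p ≤ 1) :
    -- the coherent information of the channel
    (IsGreatest (coherentInfoValues (erasureChannel d p))
        (channelCoherentInfo (erasureChannel d p)) ∧
      channelCoherentInfo (erasureChannel d p) = max 0 (1 - 2 * p) * Real.log d) ∧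
    -- the exponential bound on the fidelity
    (∀ s : ℝ, -(1 / 2) ≤ s → s < 0 → ∀ n a m : ℕ, 1 ≤ n →
      ∀ φ : Fin a × Fin m → ℂ, IsInformationState φ →
      ∀ T : Matrix (Fin n → Option (Fin d)) (Fin n → Option (Fin d)) ℂ →
          Matrix (Fin m) (Fin m) ℂ, IsChannel T →
        (∀ ρ : Matrix (Fin a × (Fin n → Fin d)) (Fin a × (Fin n → Fin d)) ℂ,
          IsMaxEntangled (d ^ n) ρ →
          pureFidelity φ (decodedState d p n m T ρ) ≤
            Real.exp (n * (s * commRate n m - erasureE0 d p s))) ∧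
        (∀ E : Matrix (Fin m) (Fin m) ℂ → Matrix (Fin n → Fin d) (Fin n → Fin d) ℂ,
          IsChannel E → IsMaxEntangled (d ^ n) (applyRight E (ketbra φ)) →
          pureFidelity φ (decodedState d p n m T (applyRight E (ketbra φ))) ≤
            Real.exp (n * (s * commRate n m - erasureE0 d p s)))) ∧
    -- exponential decay at all rates above the coherent information
    (∀ R : ℝ, channelCoherentInfo (erasureChannel d p) < R → ∃ c : ℝ, 0 < c ∧
      ∀ n a m : ℕ, 1 ≤ n → R ≤ commRate n m →
      ∀ φ : Fin a × Fin m → ℂ, IsInformationState φ →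
      ∀ T : Matrix (Fin n → Option (Fin d)) (Fin n → Option (Fin d)) ℂ →
          Matrix (Fin m) (Fin m) ℂ, IsChannel T →
        (∀ ρ : Matrix (Fin a × (Fin n → Fin d)) (Fin a × (Fin n → Fin d)) ℂ,
          IsMaxEntangled (d ^ n) ρ →
          pureFidelity φ (decodedState d p n m T ρ) ≤ Real.exp (-(c * n))) ∧
        (∀ E : Matrix (Fin m) (Fin m) ℂ → Matrix (Fin n → Fin d) (Fin n → Fin d) ℂ,
          IsChannel E → IsMaxEntangled (d ^ n) (applyRight E (ketbra φ)) →
          pureFidelity φ (decodedState d p n m T (applyRight E (ketbra φ))) ≤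
            Real.exp (-(c * n)))) := by
  obtain ⟨hQ, hexp, hconverse⟩ := theorem3_general d hd p hp0 hp1
  refine ⟨hQ, fun s hs1 hs0 n a m hn φ hφ T hT => ?_, fun R hR => ?_⟩
  · have key := hexp s (by linarith) hs0.le n m (Fin a) hn φ hφ T hT
    exact ⟨key, fun E _ => key _⟩
  · have hR' := (mul_le_mul_of_nonneg_right (le_max_right 0 (1 - 2 * p))
      (Real.log_natCast_nonneg d)).trans_lt (hQ.2 ▸ hR)
    obtain ⟨c, hc, key⟩ := hconverse R hR'
    exact ⟨c, hc, fun n a m hn hrate φ hφ T hT =>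
      have key := key n m (Fin a) hn hrate φ hφ T hT
      ⟨key, fun E _ => key _⟩⟩
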